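/- Setting. Let $\mathscr X\subseteq\mathbb R^n$ be open, $s\le T$, and let $\mathbf F_{\mathbf w}(x,t)=f(x,t)+g(x,t)u_{cl}(x,t)+\psi(x,t)\mathbf w(t)$ be the closed-loop vector field of a control-affine system with feedback $u_{cl}$ and fault profile $\mathbf w$. Let $\sigma(x,t)\in\mathbb R^{n\times q}$ and $\Sigma=\sigma\sigma^\top$. Assume that $\mathbf F_{\mathbf w}$ and its first-order, and $\Sigma$ and its first- and second-order, $x$-derivatives exist and are jointly continuous on $\mathscr X\times[s,T]$. The stochastic fault dynamics are $dx=\mathbf F_{\mathbf w}(x,t)\,dt+\sigma(x,t)\,d\mathscr W(t)$. Theorem (Probability flow PF operator). Let $\rho$ be a strictly positive function on $\mathscr X\times[s,T]$, twice differentiable in $x$ with $\rho$ and its $x$-derivatives up to order two jointly continuous, that solves the Fokker–Planck equation $$\frac{\partial\rho}{\partial t}=-\nabla\cdot(\rho\,\mathbf F_{\mathbf w})+\tfrac12\,\nabla\cdot\nabla\cdot(\rho\,\Sigma)\quad\text{on }\mathscr X\times[s,T],$$ (with one-sided time derivatives at $s$ and $T$), and put $\rho_s=\rho(\cdot,s)$.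 Define $$\mathbf v_{\mathbf w}=\mathbf F_{\mathbf w}-\tfrac12\bigl[(\nabla\cdot\Sigma)+\Sigma\nabla\log\rho\bigr],\qquad (\nabla\cdot\Sigma)_i=\sum_j\frac{\partial\Sigma_{ij}}{\partial x_j}.$$ 1. $\rho$ satisfies the continuity (Liouville) equation $\partial_t\rho+\nabla\cdot(\mathbf v_{\mathbf w}\rho)=0$ at every point of $\mathscr X\times[s,T]$. 2. Suppose that $\rho(\cdot,t)$ is a probability density on $\mathscr X$ for every $t\in[s,T]$ and that $\mathbf v_{\mathbf w}$ generates a flow on $\mathscr X$ from time $s$, that is, there are maps $\Phi_{s,t}:\mathscr X\to\mathscr X$, $s\le t\le T$, with $\Phi_{s,s}=\mathrm{id}$ and $\frac{d}{dt}\Phi_{s,t}(x)=\mathbf v_{\mathbf w}(\Phi_{s,t}(x),t)$. Then for all $t\in[s,T]$ the measure $\rho(x,t)\,dx$ is the pushforward of $\rho_s(x)\,dx$ by $\Phi_{s,t}$; equivalently $\rho(\cdot,t)=\mathscr P_{s,t}\rho_s$ almost everywhere on $\mathscr X$, where the Perron–Frobenius operator $\mathscr P_{s,t}$ sends a density $\eta$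 to the Radon–Nikodym derivative, with respect to Lebesgue measure on $\mathscr X$, of the pushforward of $\eta(x)\,dx$ by $\Phi_{s,t}$. 3. Hence, under the assumptions of part 2, the deterministic probability flow reproduces the marginals of the stochastic dynamics: if $Y$ is a weak solution on $[s,T]$, with continuous paths in $\mathscr X$, of $dx=\mathbf F_{\mathbf w}\,dt+\sigma\,d\mathscr W$ (in the sense of the martingale problem for its generator with smooth test functions compactly supported in $\mathscr X$) such that $Y_t$ has density $\rho(\cdot,t)$ for every $t\in[s,T]$, then $\mathrm{Law}(Y_t)=(\Phi_{s,t})_{\#}\mathrm{Law}(Y_s)$ for every $t\in[s,T]$. -/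

import Mathlib

open MeasureTheory ProbabilityTheory Set
open scoped Matrix

noncomputable section

namespace ProbFlow

/-- The Euclidean space of dimension `n`. -/
abbrev E (n : ℕ) : Type := EuclideanSpace ℝ (Fin n)

/-! ### Spatial derivatives -/

/-- The partial derivative `∂f/∂xᵢ` at `x`. -/
def pderiv {n : ℕ} (i : Fin n) (f : E n → ℝ) (x : E n) : ℝ :=
  fderiv ℝ f x (EuclideanSpace.single i 1)

/-- The divergence `∑ᵢ ∂uᵢ/∂xᵢ` of a vector field. -/
def divergence {n : ℕ} (u : E n → E n) (x : E n) : ℝ :=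
  ∑ i, pderiv i (fun y => u y i) x

/-- The row-wise divergence `(∇·A)ᵢ = ∑ⱼ ∂Aᵢⱼ/∂xⱼ` of a matrix field. -/
def rowDiv {n : ℕ} (A : E n → Matrix (Fin n) (Fin n) ℝ) (x : E n) : E n :=
  WithLp.toLp 2 fun i => ∑ j, pderiv j (fun y => A y i j) x

/-- The gradient `(∂f/∂x₁, …, ∂f/∂xₙ)`. -/
def grad {n : ℕ} (f : E n → ℝ) (x : E n) : E n :=
  WithLp.toLp 2 fun i => pderiv i f x

/-- The product of a matrix and a Euclidean vector. -/
def mulVecE {m n : ℕ} (A : Matrix (Fin n) (Fin m) ℝ) (u : E m) : E n :=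
  WithLp.toLp 2 (A *ᵥ u.ofLp)

/-- `u(x,t)` is once differentiable in `x` on `X × I` (with `X` open), and `u` and its spatial
derivative are jointly continuous on `X × I`. -/
structure SpaceC1 {n : ℕ} {G : Type*} [NormedAddCommGroup G] [NormedSpace ℝ G]
    (X : Set (E n)) (I : Set ℝ) (u : E n → ℝ → G) : Prop where
  diff : ∀ t ∈ I, ∀ x ∈ X, DifferentiableAt ℝ (fun y => u y t) x
  cont : ContinuousOn (fun p : E n × ℝ => u p.1 p.2) (X ×ˢ I)
  cont_fderiv : ContinuousOn (fun p : E n × ℝ => fderiv ℝ (fun y => u y p.2) p.1) (X ×ˢ I)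

/-- `u(x,t)` is twice differentiable in `x` on `X × I` (with `X` open), and `u` and its first two
spatial derivatives are jointly continuous on `X × I`. -/
structure SpaceC2 {n : ℕ} {G : Type*} [NormedAddCommGroup G] [NormedSpace ℝ G]
    (X : Set (E n)) (I : Set ℝ) (u : E n → ℝ → G) : Prop where
  fst : SpaceC1 X I u
  snd : SpaceC1 X I (fun x t => fderiv ℝ (fun y => u y t) x)

/-! ### The dynamics -/

/-- The closed-loop field `F_w(x,t) = f(x,t) + g(x,t) u_cl(x,t) + ψ(x,t) w(t)`. -/
def closedLoop {n m p : ℕ} (f : E n → ℝ → E n) (g : E n → ℝ → Matrix (Fin n) (Fin m) ℝ)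
    (ψ : E n → ℝ → Matrix (Fin n) (Fin p) ℝ) (ucl : E n → ℝ → E m) (w : ℝ → E p)
    (x : E n) (t : ℝ) : E n :=
  f x t + mulVecE (g x t) (ucl x t) + mulVecE (ψ x t) (w t)

/-- The diffusion matrix `Σ = σ σᵀ`. -/
def diffusion {n q : ℕ} (σ : E n → ℝ → Matrix (Fin n) (Fin q) ℝ) (x : E n) (t : ℝ) :
    Matrix (Fin n) (Fin n) ℝ :=
  σ x t * (σ x t)ᵀ

/-- The right-hand side `-∇·(ρF) + ½ ∇·(∇·(ρΣ))` of the Fokker–Planck equation. -/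
def fokkerPlanckRHS {n : ℕ} (F : E n → ℝ → E n) (S : E n → ℝ → Matrix (Fin n) (Fin n) ℝ)
    (ρ : E n → ℝ → ℝ) (x : E n) (t : ℝ) : ℝ :=
  -divergence (fun y => ρ y t • F y t) x
    + (1 / 2) * divergence (rowDiv fun y => ρ y t • S y t) x

/-- `ρ` is a classical solution on `X × [s,T]` of the Fokker–Planck equation with drift `F` and
diffusion matrix `S` (one-sided time derivatives at the two end points). -/
structure IsFokkerPlanckSolution {n : ℕ} (X : Set (E n)) (s T : ℝ) (F : E n → ℝ → E n)
    (S : E n → ℝ → Matrix (Fin n) (Fin n) ℝ) (ρ : E n → ℝ → ℝ) : Prop where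
  smooth : SpaceC2 X (Icc s T) ρ
  eqn : ∀ t ∈ Icc s T, ∀ x ∈ X,
    HasDerivWithinAt (fun τ => ρ x τ) (fokkerPlanckRHS F S ρ x t) (Icc s T) t

/-- The probability-flow velocity `v = F - ½ [∇·Σ + Σ ∇ log ρ]`. -/
def probFlowVelocity {n : ℕ} (F : E n → ℝ → E n) (S : E n → ℝ → Matrix (Fin n) (Fin n) ℝ)
    (ρ : E n → ℝ → ℝ) (x : E n) (t : ℝ) : E n :=
  F x t - (1 / 2 : ℝ) •
    (rowDiv (fun y => S y t) x + mulVecE (S x t) (grad (fun y => Real.log (ρ y t)) x))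

/-- `ρ` satisfies the continuity (Liouville) equation `∂ρ/∂t + ∇·(vρ) = 0` classically on
`X × [s,T]`; the flux `vρ` is required to be differentiable in `x`. -/
def SatisfiesContinuityEq {n : ℕ} (X : Set (E n)) (s T : ℝ) (v : E n → ℝ → E n)
    (ρ : E n → ℝ → ℝ) : Prop :=
  ∀ t ∈ Icc s T, ∀ x ∈ X,
    DifferentiableAt ℝ (fun y => ρ y t • v y t) x ∧
    HasDerivWithinAt (fun τ => ρ x τ) (-divergence (fun y => ρ y t • v y t) x) (Icc s T) t

/-- `v` generates the flow `Φ t = Φ_{s,t} : X → X`, `s ≤ t ≤ T`, from the initial time `s`: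
`Φ_{s,s} = id`, and `t ↦ Φ_{s,t}(x)` solves `ẋ = v(x,t)` on `[s,T]` and stays in `X`. -/
structure GeneratesFlow {n : ℕ} (X : Set (E n)) (s T : ℝ) (v : E n → ℝ → E n)
    (Φ : ℝ → E n → E n) : Prop where
  mapsTo : ∀ t ∈ Icc s T, MapsTo (Φ t) X X
  init : ∀ x ∈ X, Φ s x = x
  ode : ∀ x ∈ X, ∀ t ∈ Icc s T, HasDerivWithinAt (fun τ => Φ τ x) (v (Φ t x) t) (Icc s T) t

/-! ### Densities and Perron–Frobenius operators -/

/-- `η` is a probability density on `X` with respect to Lebesgue measure. -/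
structure IsProbDensity {n : ℕ} (X : Set (E n)) (η : E n → ℝ) : Prop where
  nonneg : ∀ x ∈ X, 0 ≤ η x
  integrable : IntegrableOn η X
  integral_eq : ∫ x in X, η x = 1

/-- The measure `η(x) dx` on `X`. -/
def densityMeasure {n : ℕ} (X : Set (E n)) (η : E n → ℝ) : Measure (E n) :=
  (volume.restrict X).withDensity fun x => ENNReal.ofReal (η x)

/-- The Perron–Frobenius operator on measures: push-forward along `Φ`. -/
def pfMeasure {n : ℕ} (Φ : E n → E n) (μ : Measure (E n)) : Measure (E n) :=
  μ.map Φ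

/-- The Perron–Frobenius operator on densities: the Radon–Nikodym derivative, with respect to
Lebesgue measure on `X`, of the push-forward of `η(x) dx` along `Φ`. -/
def pfDensity {n : ℕ} (X : Set (E n)) (Φ : E n → E n) (η : E n → ℝ) (x : E n) : ℝ :=
  ((pfMeasure Φ (densityMeasure X η)).rnDeriv (volume.restrict X) x).toReal

/-! ### The stochastic dynamics -/

/-- The generator `∑ᵢ Fᵢ ∂ᵢφ + ½ ∑ᵢⱼ Σᵢⱼ ∂ᵢ∂ⱼφ` of the Itô equation `dx = F dt + σ dW`. -/
def generator {n : ℕ} (F : E n → ℝ → E n) (S : E n → ℝ → Matrix (Fin n) (Fin n) ℝ)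
    (φ : E n → ℝ) (x : E n) (t : ℝ) : ℝ :=
  ∑ i, F x t i * pderiv i φ x + (1 / 2) * ∑ i, ∑ j, S x t i j * pderiv i (pderiv j φ) x

/-- The process `Y`, with continuous paths in `X`, is a weak solution on `[s,T]` of the Itô
equation `dx = F dt + σ dW`, in the martingale-problem formulation: it is adapted to the
filtration `ℱ`, and `φ(Yₜ) - ∫ₛᵗ (Lφ)(Yᵣ,r) dr` is an `ℱ`-martingale on `[s,T]` for every smooth
`φ` with compact support in `X`, `L` being the generator with diffusion matrix `σ σᵀ`. -/
structure IsSDESolution {n q : ℕ} {Ω : Type*} [mΩ : MeasurableSpace Ω] (X : Set (E n)) (s T : ℝ)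
    (F : E n → ℝ → E n) (σ : E n → ℝ → Matrix (Fin n) (Fin q) ℝ)
    (P : Measure Ω) (ℱ : Filtration ℝ mΩ) (Y : ℝ → Ω → E n) : Prop where
  mem : ∀ t ∈ Icc s T, ∀ ω, Y t ω ∈ X
  path_continuous : ∀ ω, ContinuousOn (fun t => Y t ω) (Icc s T)
  adapted : ∀ t ∈ Icc s T, Measurable[ℱ t] (Y t)
  martingale : ∀ φ : E n → ℝ, ContDiff ℝ (⊤ : ℕ∞) φ → HasCompactSupport φ → tsupport φ ⊆ X →
    ∀ r ∈ Icc s T, ∀ t ∈ Icc s T, r ≤ t →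
      Integrable (fun ω => φ (Y t ω) - ∫ τ in s..t, generator F (diffusion σ) φ (Y τ ω) τ) P ∧
      P[fun ω => φ (Y t ω) - ∫ τ in s..t, generator F (diffusion σ) φ (Y τ ω) τ | ℱ r] =ᵐ[P]
        fun ω => φ (Y r ω) - ∫ τ in s..r, generator F (diffusion σ) φ (Y τ ω) τ

end ProbFlow

end

/-! Since `ρ ∇log ρ = ∇ρ`, the product rule gives `ρ v = ρ F - ½ ∇·(ρ Σ)` (`smul_probFlowVelocity`).
The second-order term of the Fokker–Planck equation is thus part of a first-order flux, and the
equation is already `∂ₜρ = -∇·(ρ v)`.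

Along a trajectory of `v` the continuity equation reads `dρ/dt = -ρ ∇·v`, while Liouville's formula
gives `d/dt det DΦ = (∇·v) det DΦ`. Hence `ρ(Φ x, t) det DΦ(x)` keeps its initial value `ρ(x, s)`
(`GeneratesFlow.exists_hasFDerivAt_mul_det`). With injectivity of the flow, the change of variables
formula bounds the push-forward of `ρ_s dx` by `ρ_t dx`. Both have mass one, so they agree, and
surjectivity of the flow is never needed. The statement on laws follows because the laws at times
`s` and `t` are these two measures.

The flow is given only as a family of trajectories, so its differentiability in `x` has to be
proved. The linearized equation is solved on all of `[s,T]`, and Grönwall's inequality in a tube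
around a trajectory identifies its solution with `DΦ` (`hasFDerivAt_flow`). -/

namespace ProbFlow

/-! ### Ordinary differential equations: linear equations, stability, dependence on initial values
-/

section ODE

open scoped NNReal Topology

variable {V : Type*} [NormedAddCommGroup V] [NormedSpace ℝ V]

/-- Radial truncation to the ball of radius `R` makes a linear field bounded while keeping it
Lipschitz. In the constant `2`, one unit comes from the scaling factor being at most `1`, the other
from the variation of that factor. -/
theorem norm_truncate_sub_le {R : ℝ} (hR : 0 < R) (x y : V) :
    ‖(R / max R ‖x‖) • x - (R / max R ‖y‖) • y‖ ≤ 2 * ‖x - y‖ := by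
  have hx : 0 < max R ‖x‖ := lt_of_lt_of_le hR (le_max_left _ _)
  have hy : 0 < max R ‖y‖ := lt_of_lt_of_le hR (le_max_left _ _)
  have h1 : (R / max R ‖x‖) • x - (R / max R ‖y‖) • y
      = (R / max R ‖x‖) • (x - y) + (R / max R ‖x‖ - R / max R ‖y‖) • y := by
    rw [smul_sub, sub_smul]; abel
  have hq : R / max R ‖x‖ ≤ 1 := (div_le_one hx).2 (le_max_left _ _)
  have hq0 : 0 ≤ R / max R ‖x‖ := by positivity
  have h2 : R / max R ‖x‖ - R / max R ‖y‖
      = (R / max R ‖x‖) * ((max R ‖y‖ - max R ‖x‖) / max R ‖y‖) := by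
    field_simp
  have h3 : |max R ‖y‖ - max R ‖x‖| ≤ ‖x - y‖ := by
    refine (abs_max_sub_max_le_max _ _ _ _).trans ?_
    rw [sub_self, abs_zero, max_eq_right (abs_nonneg _), norm_sub_rev]
    exact abs_norm_sub_norm_le _ _
  rw [h1]
  refine (norm_add_le _ _).trans ?_
  rw [norm_smul, norm_smul, h2, Real.norm_of_nonneg hq0, Real.norm_eq_abs, abs_mul,
    abs_of_nonneg hq0, abs_div, abs_of_pos hy]
  have h4 : |max R ‖y‖ - max R ‖x‖| / max R ‖y‖ * ‖y‖ ≤ ‖x - y‖ := by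
    rw [div_mul_eq_mul_div, div_le_iff₀ hy]
    exact mul_le_mul h3 (le_max_right _ _) (norm_nonneg _) (norm_nonneg _)
  have h5 := mul_le_of_le_one_left (norm_nonneg (x - y)) hq
  have h6 : R / max R ‖x‖ * (|max R ‖y‖ - max R ‖x‖| / max R ‖y‖) * ‖y‖ ≤ ‖x - y‖ := by
    rw [mul_assoc]
    exact (mul_le_of_le_one_left (by positivity) hq).trans h4
  linarith

theorem norm_truncate_le {R : ℝ} (hR : 0 < R) (x : V) :
    ‖(R / max R ‖x‖) • x‖ ≤ min R ‖x‖ := by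
  have hx : 0 < max R ‖x‖ := lt_of_lt_of_le hR (le_max_left _ _)
  rw [norm_smul, Real.norm_of_nonneg (by positivity), le_min_iff]
  constructor
  · rw [div_mul_eq_mul_div, div_le_iff₀ hx]
    exact mul_le_mul_of_nonneg_left (le_max_right _ _) hR.le
  · exact mul_le_of_le_one_left (norm_nonneg _) ((div_le_one hx).2 (le_max_left _ _))

theorem hasDerivWithinAt_Ici_of_Icc {f : ℝ → V} {f' : V} {a b t : ℝ}
    (h : HasDerivWithinAt f f' (Icc a b) t) (ht : t ∈ Ico a b) :
    HasDerivWithinAt f f' (Ici t) t :=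
  (h.mono (Icc_subset_Icc_left ht.1)).mono_of_mem_nhdsWithin (Icc_mem_nhdsGE ht.2)

/-- A linear equation `y' = A(t) y` with continuous coefficients has a solution on the whole
interval. -/
theorem exists_linear_ode_solution [CompleteSpace V] {a b : ℝ} (hab : a ≤ b) {A : ℝ → V →L[ℝ] V}
    (hA : ContinuousOn A (Icc a b)) (y₀ : V) :
    ∃ y : ℝ → V, y a = y₀ ∧ ∀ t ∈ Icc a b, HasDerivWithinAt y (A t (y t)) (Icc a b) t := by
  obtain ⟨M, hM⟩ := isCompact_Icc.exists_bound_of_continuousOn hA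
  have hM0 : 0 ≤ M := (norm_nonneg _).trans (hM a (left_mem_Icc.2 hab))
  -- `R` exceeds the Grönwall bound for the linear equation on the whole interval, so the truncation
  -- is never active along the solution.
  set R : ℝ := ‖y₀‖ * Real.exp (M * (b - a)) + 1 with hRdef
  have hR : 0 < R := by positivity
  have hba : 0 ≤ b - a := sub_nonneg.2 hab
  -- The truncated field is bounded by `M * R` everywhere, so a ball of radius `M * R * (b - a)`
  -- confines the solution up to time `b`.
  have hPL : IsPicardLindelof (fun t y => A t ((R / max R ‖y‖) • y))
      (⟨a, left_mem_Icc.2 hab⟩ : Icc a b) y₀ (⟨M * R * (b - a), by positivity⟩ : ℝ≥0) 0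
      (⟨M * R, by positivity⟩ : ℝ≥0) (⟨M * 2, by positivity⟩ : ℝ≥0) := by
    refine ⟨fun t ht => ?_, fun x _ => ?_, fun t ht x _ => ?_, ?_⟩
    · refine (LipschitzWith.of_dist_le_mul fun x y => ?_).lipschitzOnWith
      rw [dist_eq_norm, dist_eq_norm, ← map_sub]
      refine ((A t).le_opNorm _).trans ?_
      refine (mul_le_mul (hM t ht) (norm_truncate_sub_le hR x y) (norm_nonneg _) hM0).trans ?_
      rw [← mul_assoc]; rfl
    · exact hA.clm_apply continuousOn_const
    · refine ((A t).le_opNorm _).trans ?_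
      exact mul_le_mul (hM t ht) ((norm_truncate_le hR x).trans (min_le_left _ _))
        (norm_nonneg _) hM0
    · simp only [sub_self, max_eq_left hba, NNReal.coe_zero, sub_zero]
      exact le_rfl
  obtain ⟨y, hy0, hy⟩ := hPL.exists_eq_forall_mem_Icc_hasDerivWithinAt₀
  refine ⟨y, hy0, fun t ht => ?_⟩
  have hbound : ∀ t ∈ Icc a b, ‖y t‖ ≤ gronwallBound ‖y₀‖ M 0 (t - a) := by
    refine norm_le_gronwallBound_of_norm_deriv_right_le
      (fun t ht => (hy t ht).continuousWithinAt)
      (fun t ht => hasDerivWithinAt_Ici_of_Icc (hy t (Ico_subset_Icc_self ht)) ht)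
      (by rw [show y a = y₀ from hy0]) fun t ht => ?_
    rw [add_zero]
    refine ((A t).le_opNorm _).trans ?_
    exact mul_le_mul (hM t (Ico_subset_Icc_self ht))
      ((norm_truncate_le hR _).trans (min_le_right _ _)) (norm_nonneg _) hM0
  have hle : ‖y t‖ ≤ R := by
    refine (hbound t ht).trans ?_
    rw [gronwallBound_ε0, hRdef]
    have : ‖y₀‖ * Real.exp (M * (t - a)) ≤ ‖y₀‖ * Real.exp (M * (b - a)) := by
      have := ht.2
      gcongr
    linarith
  have := hy t ht
  rwa [max_eq_left hle, div_self hR.ne', one_smul] at this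

/-- Two trajectories that start close to each other stay close as long as the vector field is
Lipschitz in a tube around one of them. -/
theorem dist_trajectories_le {a b δ : ℝ} {K : ℝ≥0} {v : ℝ → V → V} {γ₀ γ : ℝ → V}
    (hv : ∀ t ∈ Icc a b, LipschitzOnWith K (v t) (Metric.ball (γ₀ t) δ))
    (h₀ : ∀ t ∈ Icc a b, HasDerivWithinAt γ₀ (v t (γ₀ t)) (Icc a b) t)
    (h : ∀ t ∈ Icc a b, HasDerivWithinAt γ (v t (γ t)) (Icc a b) t)
    (hδ : dist (γ a) (γ₀ a) * Real.exp (K * (b - a)) < δ) :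
    ∀ t ∈ Icc a b, dist (γ t) (γ₀ t) ≤ dist (γ a) (γ₀ a) * Real.exp (K * (t - a)) ∧
      dist (γ t) (γ₀ t) < δ := by
  have hc₀ : ContinuousOn γ₀ (Icc a b) := fun t ht => (h₀ t ht).continuousWithinAt
  have hc : ContinuousOn γ (Icc a b) := fun t ht => (h t ht).continuousWithinAt
  have hδ0 : 0 < δ := lt_of_le_of_lt (by positivity) hδ
  have hmono : ∀ c ∈ Icc a b, dist (γ a) (γ₀ a) * Real.exp (K * (c - a)) < δ := by
    intro c hc'
    refine lt_of_le_of_lt ?_ hδ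
    have := hc'.2
    gcongr
  -- Grönwall's inequality up to time `c` uses the tube only on `[a, c)`, so its estimate also holds
  -- at a possible first exit time.
  have key : ∀ c ∈ Icc a b, (∀ t ∈ Ico a c, dist (γ t) (γ₀ t) < δ) →
      dist (γ c) (γ₀ c) ≤ dist (γ a) (γ₀ a) * Real.exp (K * (c - a)) := by
    intro c hc' hlt
    have hsub : Icc a c ⊆ Icc a b := Icc_subset_Icc_right hc'.2
    refine dist_le_of_trajectories_ODE_of_mem (s := fun t => Metric.ball (γ₀ t) δ) (a := a) (b := c)
      (v := v) (fun t ht => hv t (hsub (Ico_subset_Icc_self ht))) (hc.mono hsub)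
      (fun t ht => hasDerivWithinAt_Ici_of_Icc (h t (hsub (Ico_subset_Icc_self ht)))
        ⟨ht.1, ht.2.trans_le hc'.2⟩)
      (fun t ht => hlt t ht) (hc₀.mono hsub)
      (fun t ht => hasDerivWithinAt_Ici_of_Icc (h₀ t (hsub (Ico_subset_Icc_self ht)))
        ⟨ht.1, ht.2.trans_le hc'.2⟩)
      (fun t ht => Metric.mem_ball_self hδ0) le_rfl c (right_mem_Icc.2 hc'.1)
  -- At the first time with distance at least `δ`, `key` gives a distance below `δ`, a
  -- contradiction.
  have hall : ∀ t ∈ Icc a b, dist (γ t) (γ₀ t) < δ := by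
    by_contra! hcon
    obtain ⟨t₁, ht₁, hge⟩ := hcon
    have hcl : IsCompact (Icc a b ∩ (fun t => dist (γ t) (γ₀ t)) ⁻¹' Ici δ) :=
      isCompact_Icc.of_isClosed_subset
        ((continuous_dist.comp_continuousOn (hc.prodMk hc₀)).preimage_isClosed_of_isClosed isClosed_Icc isClosed_Ici) inter_subset_left
    obtain ⟨c, ⟨hcI, hcδ⟩, hcmin⟩ := hcl.exists_isLeast ⟨t₁, ht₁, hge⟩
    have := key c hcI fun t ht => by
      by_contra! hge'
      exact absurd (hcmin ⟨⟨ht.1, ht.2.le.trans hcI.2⟩, hge'⟩) (not_le.2 ht.2)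
    exact absurd (this.trans_lt (hmono c hcI)) (not_lt.2 hcδ)
  exact fun t ht =>
    ⟨key t ht fun τ hτ => hall τ ⟨hτ.1, hτ.2.le.trans ht.2⟩, hall t ht⟩

/-- Two trajectories that meet at the final time coincide. -/
theorem trajectories_eq_of_final_eq {a b δ : ℝ} (hab : a ≤ b) (hδ : 0 < δ) {K : ℝ≥0}
    {v : ℝ → V → V} {γ₀ γ : ℝ → V}
    (hv : ∀ t ∈ Icc a b, LipschitzOnWith K (v t) (Metric.ball (γ₀ t) δ))
    (h₀ : ∀ t ∈ Icc a b, HasDerivWithinAt γ₀ (v t (γ₀ t)) (Icc a b) t)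
    (h : ∀ t ∈ Icc a b, HasDerivWithinAt γ (v t (γ t)) (Icc a b) t)
    (hb : γ b = γ₀ b) : γ a = γ₀ a := by
  have hmem : ∀ t ∈ Icc (-b) (-a), -t ∈ Icc a b := fun t ht =>
    ⟨by linarith [ht.2], by linarith [ht.1]⟩
  -- Time reversal turns the common final value into a common initial value.
  have hrev : ∀ η : ℝ → V, (∀ t ∈ Icc a b, HasDerivWithinAt η (v t (η t)) (Icc a b) t) →
      ∀ t ∈ Icc (-b) (-a),
        HasDerivWithinAt (fun τ => η (-τ)) (-v (-t) (η (-t))) (Icc (-b) (-a)) t := by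
    intro η hη t ht
    have := (hη (-t) (hmem t ht)).scomp t (hasDerivWithinAt_neg t (Icc (-b) (-a))) hmem
    simpa [Function.comp_def] using this
  have := dist_trajectories_le (a := -b) (b := -a) (δ := δ) (K := K) (v := fun t x => -v (-t) x)
    (γ₀ := fun τ => γ₀ (-τ)) (γ := fun τ => γ (-τ))
    (fun t ht => LipschitzOnWith.of_dist_le_mul fun x hx y hy => by
      rw [dist_neg_neg]; exact (hv _ (hmem t ht)).dist_le_mul x hx y hy)
    (hrev γ₀ h₀) (hrev γ h) (by simpa [hb] using hδ) (-a) (right_mem_Icc.2 (neg_le_neg hab))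
  simpa [hb] using this.1

/-- Grönwall's inequality with zero initial value, in a form linear in the inhomogeneity `e`; this
linearity yields the little-o estimate for the flow. -/
theorem norm_le_of_linear_perturbation {a b M : ℝ} (hM : 0 < M) {z z' : ℝ → V} {e : ℝ} (he : 0 ≤ e)
    (hz : ∀ t ∈ Icc a b, HasDerivWithinAt z (z' t) (Icc a b) t) (ha : z a = 0)
    (bound : ∀ t ∈ Icc a b, ‖z' t‖ ≤ M * ‖z t‖ + e) :
    ∀ t ∈ Icc a b, ‖z t‖ ≤ e * (Real.exp (M * (b - a)) / M) := by
  intro t ht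
  have := norm_le_gronwallBound_of_norm_deriv_right_le (δ := 0)
    (fun t ht => (hz t ht).continuousWithinAt)
    (fun t ht => hasDerivWithinAt_Ici_of_Icc (hz t (Ico_subset_Icc_self ht)) ht)
    (by simp [ha]) (fun t ht => bound t (Ico_subset_Icc_self ht)) t ht
  refine this.trans ?_
  simp only [gronwallBound_of_K_ne_0 hM.ne']
  rw [zero_mul, zero_add, ← mul_div_assoc, div_mul_eq_mul_div]
  gcongr
  have h1 : Real.exp (M * (t - a)) ≤ Real.exp (M * (b - a)) := by
    have := ht.2
    gcongr
  linarith

/-- Differentiability of solutions with respect to the initial value: the derivative solves the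
linearized equation. -/
theorem hasFDerivAt_flow {a b δ : ℝ} (hδ : 0 < δ) {K : ℝ≥0}
    {v : ℝ → V → V} {v' : ℝ → V → V →L[ℝ] V} {Φ : ℝ → V → V} {x₀ : V} {U : Set V} (hU : U ∈ 𝓝 x₀)
    (hx₀ : x₀ ∈ U)
    (hv : ∀ t ∈ Icc a b, LipschitzOnWith K (v t) (Metric.ball (Φ t x₀) δ))
    (hv' : ∀ t ∈ Icc a b, ∀ y ∈ Metric.ball (Φ t x₀) δ, HasFDerivAt (v t) (v' t y) y)
    (hvu : ∀ ε > 0, ∃ η > 0, ∀ t ∈ Icc a b, ∀ y ∈ Metric.ball (Φ t x₀) η,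
      ‖v' t y - v' t (Φ t x₀)‖ ≤ ε)
    (hinit : ∀ x ∈ U, Φ a x = x)
    (hode : ∀ x ∈ U, ∀ t ∈ Icc a b, HasDerivWithinAt (Φ · x) (v t (Φ t x)) (Icc a b) t)
    {J : ℝ → V →L[ℝ] V} (hJa : J a = .id ℝ V)
    (hJ : ∀ t ∈ Icc a b, HasDerivWithinAt J ((v' t (Φ t x₀)).comp (J t)) (Icc a b) t) :
    ∀ t ∈ Icc a b, HasFDerivAt (Φ t) (J t) x₀ := by
  intro t ht
  set C := Real.exp (K * (b - a)) with hC
  have hC0 : 0 < C := Real.exp_pos _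
  -- Adding `1` to `K` keeps the growth rate positive, since the Grönwall bound divides by it.
  set M : ℝ := K + 1 with hMdef
  have hM : 0 < M := by positivity
  set D := Real.exp (M * (b - a)) / M with hD
  have hD0 : 0 < D := by positivity
  have hA : ∀ τ ∈ Icc a b, ‖v' τ (Φ τ x₀)‖ ≤ M := fun τ hτ =>
    ((hv' τ hτ _ (Metric.mem_ball_self hδ)).le_of_lipschitzOn
      (Metric.ball_mem_nhds _ hδ) (hv τ hτ)).trans (by simp [hMdef])
  rw [hasFDerivAt_iff_isLittleO, Asymptotics.isLittleO_iff]
  intro c hc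
  -- `C` bounds the spreading of trajectories and `D` is the Grönwall factor for the error; dividing
  -- by both leaves exactly `c` at the end.
  obtain ⟨η, hη, hηu⟩ := hvu (c / (C * D)) (by positivity)
  set r := min η δ with hr
  have hr0 : 0 < r := lt_min hη hδ
  have hnear : ∀ᶠ x in 𝓝 x₀, dist x x₀ < r / C :=
    Metric.eventually_nhds_iff_ball.2 ⟨r / C, by positivity, fun y hy => hy⟩
  filter_upwards [hU, hnear] with x hxU hx
  have hdist := dist_trajectories_le (γ₀ := (Φ · x₀)) (γ := (Φ · x)) (δ := r)
    (fun τ hτ => (hv τ hτ).mono (Metric.ball_subset_ball (min_le_right _ _))) (hode x₀ hx₀)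
    (hode x hxU) (by
      rw [hinit x hxU, hinit x₀ hx₀]
      exact (lt_div_iff₀ hC0).1 hx)
  rw [hinit x hxU, hinit x₀ hx₀] at hdist
  -- The first-order error solves the linearized equation up to the Taylor remainder of `v`.
  have hz : ∀ τ ∈ Icc a b, HasDerivWithinAt (fun τ => Φ τ x - Φ τ x₀ - J τ (x - x₀))
      (v τ (Φ τ x) - v τ (Φ τ x₀) - v' τ (Φ τ x₀) (J τ (x - x₀))) (Icc a b) τ := by
    intro τ hτ
    have h1 := (hJ τ hτ).clm_apply (hasDerivWithinAt_const τ (Icc a b) (x - x₀))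
    refine (((hode x hxU τ hτ).fun_sub (hode x₀ hx₀ τ hτ)).fun_sub h1).congr_deriv ?_
    simp
  have hb := norm_le_of_linear_perturbation (e := c / D * ‖x - x₀‖) hM (by positivity) hz
    (by simp [hinit x hxU, hinit x₀ hx₀, hJa]) ?_ t ht
  · refine hb.trans (le_of_eq ?_)
    rw [← hD]
    field_simp
  · intro τ hτ
    obtain ⟨hd1, hd2⟩ := hdist τ hτ
    have hrem : ‖v τ (Φ τ x) - v τ (Φ τ x₀) - v' τ (Φ τ x₀) (Φ τ x - Φ τ x₀)‖
        ≤ c / (C * D) * ‖Φ τ x - Φ τ x₀‖ := by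
      refine (convex_ball (Φ τ x₀) r).norm_image_sub_le_of_norm_hasFDerivWithin_le'
        (f := v τ) (f' := v' τ) (fun y hy => (hv' τ hτ y
          (Metric.ball_subset_ball (min_le_right _ _) hy)).hasFDerivWithinAt)
        (fun y hy => hηu τ hτ y (Metric.ball_subset_ball (min_le_left _ _) hy))
        (Metric.mem_ball_self hr0) hd2
    have hd3 : ‖Φ τ x - Φ τ x₀‖ ≤ ‖x - x₀‖ * C := by
      rw [← dist_eq_norm, ← dist_eq_norm]
      refine hd1.trans ?_
      have := hτ.2
      rw [hC]
      gcongr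
    have hsplit : v τ (Φ τ x) - v τ (Φ τ x₀) - v' τ (Φ τ x₀) (J τ (x - x₀))
        = v' τ (Φ τ x₀) (Φ τ x - Φ τ x₀ - J τ (x - x₀))
          + (v τ (Φ τ x) - v τ (Φ τ x₀) - v' τ (Φ τ x₀) (Φ τ x - Φ τ x₀)) := by
      rw [map_sub _ (Φ τ x - Φ τ x₀)]; abel
    rw [hsplit]
    refine (norm_add_le _ _).trans (add_le_add ?_ ?_)
    · exact ((v' τ (Φ τ x₀)).le_opNorm _).trans
        (mul_le_mul_of_nonneg_right (hA τ hτ) (norm_nonneg _))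
    · refine hrem.trans ?_
      calc c / (C * D) * ‖Φ τ x - Φ τ x₀‖ ≤ c / (C * D) * (‖x - x₀‖ * C) := by gcongr
        _ = c / D * ‖x - x₀‖ := by field_simp

/-- The derivative of the determinant along a solution of `M' = B M` is `tr B · det M`. -/
theorem hasDerivWithinAt_matrix_det {ι : Type*} [Fintype ι] [DecidableEq ι]
    {M : ℝ → Matrix ι ι ℝ} {B : Matrix ι ι ℝ} {I : Set ℝ} {t : ℝ}
    (h : ∀ i j, HasDerivWithinAt (fun τ => M τ i j) ((B * M t) i j) I t) :
    HasDerivWithinAt (fun τ => (M τ).det) (B.trace * (M t).det) I t := by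
  let f : ContinuousMultilinearMap ℝ (fun _ : ι => ι → ℝ) ℝ :=
    ⟨(Matrix.detRowAlternating (R := ℝ) (n := ι)).toMultilinearMap,
      Continuous.matrix_det continuous_id⟩
  have hrow : ∀ i, HasFDerivWithinAt (fun τ => M τ i)
      (ContinuousLinearMap.toSpanSingleton ℝ ((B * M t) i)) I t := fun i =>
    (hasDerivWithinAt_pi.2 fun j => h i j).hasFDerivWithinAt
  have := (HasFDerivWithinAt.multilinear_comp f hrow).hasDerivWithinAt
  refine this.congr_deriv ?_
  -- Each row of `B * M` is a combination of the rows of `M`; as the determinant is alternating,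
  -- only the diagonal coefficient survives when row `i` is replaced.
  have hsum : ∀ i, (M t).updateRow i ((B * M t) i) = (M t).updateRow i (∑ k, B i k • (M t) k) := by
    intro i
    congr 1
    ext j
    simp [Matrix.mul_apply]
  have hdet : ∀ i, ((M t).updateRow i ((B * M t) i)).det = B i i * (M t).det := by
    intro i
    rw [hsum, Matrix.det_updateRow_sum, smul_eq_mul]
  simp only [sum_apply, ContinuousLinearMap.comp_apply,
    ContinuousLinearMap.toSpanSingleton_apply, one_smul]
  rw [Matrix.trace, Finset.sum_mul]
  exact Finset.sum_congr rfl fun i _ => hdet i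

end ODE

/-! ### Calculus of fields of class `C¹` in space -/

section SpaceC1

open Filter
open scoped Topology

variable {n : ℕ} {X : Set (E n)} {I : Set ℝ} {G H : Type*} [NormedAddCommGroup G]
  [NormedSpace ℝ G] [NormedAddCommGroup H] [NormedSpace ℝ H]

theorem SpaceC1.congr {u u' : E n → ℝ → G} (hX : IsOpen X) (hu : SpaceC1 X I u)
    (h : ∀ t ∈ I, ∀ x ∈ X, u' x t = u x t) : SpaceC1 X I u' := by
  have hev : ∀ t ∈ I, ∀ x ∈ X, (fun y => u' y t) =ᶠ[𝓝 x] fun y => u y t := fun t ht x hx =>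
    (hX.eventually_mem hx).mono fun y hy => h t ht y hy
  refine ⟨fun t ht x hx => (hev t ht x hx).differentiableAt_iff.2 (hu.diff t ht x hx),
    hu.cont.congr fun p hp => h p.2 hp.2 p.1 hp.1,
    hu.cont_fderiv.congr fun p hp => (hev p.2 hp.2 p.1 hp.1).fderiv_eq⟩

theorem SpaceC1.clm_comp {u : E n → ℝ → G} (L : G →L[ℝ] H) (hu : SpaceC1 X I u) :
    SpaceC1 X I (fun x t => L (u x t)) := by
  refine ⟨fun t ht x hx => L.differentiableAt.comp x (hu.diff t ht x hx),
    L.continuous.comp_continuousOn hu.cont, ?_⟩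
  refine ContinuousOn.congr (f := fun p : E n × ℝ => L.comp (fderiv ℝ (fun y => u y p.2) p.1))
    (continuousOn_const.clm_comp hu.cont_fderiv) fun p hp => ?_
  exact (L.hasFDerivAt.comp p.1 (hu.diff p.2 hp.2 p.1 hp.1).hasFDerivAt).fderiv

theorem SpaceC1.add {u u' : E n → ℝ → G} (hu : SpaceC1 X I u) (hu' : SpaceC1 X I u') :
    SpaceC1 X I (fun x t => u x t + u' x t) :=
  ⟨fun t ht x hx => (hu.diff t ht x hx).add (hu'.diff t ht x hx), hu.cont.add hu'.cont,
    (hu.cont_fderiv.add hu'.cont_fderiv).congr fun p hp =>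
      fderiv_fun_add (hu.diff p.2 hp.2 p.1 hp.1) (hu'.diff p.2 hp.2 p.1 hp.1)⟩

theorem SpaceC1.const (c : G) : SpaceC1 X I (fun _ _ => c) :=
  ⟨fun _ _ _ _ => differentiableAt_const c, continuousOn_const, by
    simpa using continuousOn_const⟩

theorem SpaceC1.sum {ι : Type*} (s : Finset ι) {u : ι → E n → ℝ → G}
    (hu : ∀ i ∈ s, SpaceC1 X I (u i)) : SpaceC1 X I (fun x t => ∑ i ∈ s, u i x t) := by
  classical
  induction s using Finset.induction_on with
  | empty => simpa using SpaceC1.const (0 : G)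
  | insert i s hi ih =>
    simp only [Finset.sum_insert hi]
    exact (hu i (Finset.mem_insert_self _ _)).add
      (ih fun j hj => hu j (Finset.mem_insert_of_mem hj))

theorem SpaceC1.mul {u u' : E n → ℝ → ℝ} (hu : SpaceC1 X I u) (hu' : SpaceC1 X I u') :
    SpaceC1 X I (fun x t => u x t * u' x t) :=
  ⟨fun t ht x hx => (hu.diff t ht x hx).mul (hu'.diff t ht x hx), hu.cont.mul hu'.cont,
    ((hu.cont.smul hu'.cont_fderiv).add (hu'.cont.smul hu.cont_fderiv)).congr fun p hp =>
      fderiv_fun_mul (hu.diff p.2 hp.2 p.1 hp.1) (hu'.diff p.2 hp.2 p.1 hp.1)⟩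

theorem SpaceC1.inv {u : E n → ℝ → ℝ} (hu : SpaceC1 X I u) (h : ∀ t ∈ I, ∀ x ∈ X, u x t ≠ 0) :
    SpaceC1 X I (fun x t => (u x t)⁻¹) := by
  refine ⟨fun t ht x hx => (hu.diff t ht x hx).inv (h t ht x hx),
    hu.cont.inv₀ fun p hp => h p.2 hp.2 p.1 hp.1, ?_⟩
  refine ContinuousOn.congr
    (f := fun p : E n × ℝ => (-(u p.1 p.2 ^ 2)⁻¹) • fderiv ℝ (fun y => u y p.2) p.1)
    ((((hu.cont.pow 2).inv₀ fun p hp => pow_ne_zero 2 (h p.2 hp.2 p.1 hp.1)).neg).smul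
      hu.cont_fderiv) fun p hp => ?_
  exact ((hasDerivAt_inv (h p.2 hp.2 p.1 hp.1)).comp_hasFDerivAt p.1
    (hu.diff p.2 hp.2 p.1 hp.1).hasFDerivAt).fderiv

theorem SpaceC1.toLp {u : Fin n → E n → ℝ → ℝ} (hu : ∀ i, SpaceC1 X I (u i)) :
    SpaceC1 X I (fun x t => (WithLp.toLp 2 fun i => u i x t : E n)) := by
  have h := SpaceC1.sum Finset.univ fun i _ =>
    (hu i).clm_comp (ContinuousLinearMap.toSpanSingleton ℝ (EuclideanSpace.single i (1 : ℝ)))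
  convert h using 3 with x t
  ext j
  simp [Pi.single_apply]

theorem SpaceC2.pderiv {u : E n → ℝ → ℝ} (hu : SpaceC2 X I u) (i : Fin n) :
    SpaceC1 X I (fun x t => pderiv i (fun y => u y t) x) :=
  hu.snd.clm_comp (ContinuousLinearMap.apply ℝ ℝ (EuclideanSpace.single i (1 : ℝ)))

/-- Chain rule along a curve, for a function of class `C¹` in space that is differentiable in
time. -/
theorem SpaceC1.hasDerivWithinAt_comp_curve {u : E n → ℝ → G} (hX : IsOpen X)
    (hu : SpaceC1 X I u) {γ : ℝ → E n} {γ' : E n} {t : ℝ} {ut : G} (ht : t ∈ I) (hγX : γ t ∈ X)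
    (hγ : HasDerivWithinAt γ γ' I t) (hut : HasDerivWithinAt (fun τ => u (γ t) τ) ut I t) :
    HasDerivWithinAt (fun τ => u (γ τ) τ) (fderiv ℝ (fun y => u y t) (γ t) γ' + ut) I t := by
  set φ := fderiv ℝ (fun y => u y t) (γ t) with hφ
  -- The spatial increment is taken at the moving time `τ`, where joint continuity keeps the
  -- derivative close to `φ`. The time derivative is then needed only at the fixed point `γ t`.
  have h1 : (fun τ => u (γ τ) τ - u (γ t) τ - φ (γ τ - γ t)) =o[𝓝[I] t] fun τ => γ τ - γ t := by
    rw [Asymptotics.isLittleO_iff]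
    intro c hc
    obtain ⟨η, hη, hηc⟩ := Metric.continuousWithinAt_iff.1 (hu.cont_fderiv (γ t, t) ⟨hγX, ht⟩) c hc
    obtain ⟨δ, hδ, hδX⟩ := Metric.isOpen_iff.1 hX (γ t) hγX
    have hγe : ∀ᶠ τ in 𝓝[I] t, γ τ ∈ Metric.ball (γ t) (min η δ) :=
      hγ.continuousWithinAt (Metric.ball_mem_nhds _ (lt_min hη hδ))
    have hte : ∀ᶠ τ in 𝓝[I] t, τ ∈ Metric.ball t η :=
      nhdsWithin_le_nhds (Metric.ball_mem_nhds _ hη)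
    filter_upwards [hγe, hte, self_mem_nhdsWithin] with τ h1 h2 hτ
    have hsub : ∀ y ∈ Metric.ball (γ t) (min η δ), y ∈ X := fun y hy =>
      hδX (Metric.ball_subset_ball (min_le_right _ _) hy)
    refine (convex_ball (γ t) (min η δ)).norm_image_sub_le_of_norm_hasFDerivWithin_le'
      (f := fun y => u y τ) (f' := fun y => fderiv ℝ (fun y => u y τ) y)
      (fun y hy => (hu.diff τ hτ y (hsub y hy)).hasFDerivAt.hasFDerivWithinAt)
      (fun y hy => ?_) (Metric.mem_ball_self (lt_min hη hδ)) h1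
    have hd : dist (y, τ) (γ t, t) < η := by
      rw [Prod.dist_eq]
      exact max_lt (Metric.ball_subset_ball (min_le_left _ _) hy) h2
    have := hηc (x := (y, τ)) ⟨hsub y hy, hτ⟩ hd
    rw [dist_eq_norm] at this
    exact this.le
  have h2 := h1.trans_isBigO hγ.differentiableWithinAt.isBigO_sub
  have h3 := (φ.isBigO_comp (fun τ => γ τ - γ t - (τ - t) • γ') (𝓝[I] t)).trans_isLittleO
    (hasDerivWithinAt_iff_isLittleO.1 hγ)
  have h4 := hasDerivWithinAt_iff_isLittleO.1 hut
  rw [hasDerivWithinAt_iff_isLittleO]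
  refine ((h2.add h3).add h4).congr_left fun τ => ?_
  simp only [map_sub, map_smul, smul_add]
  abel

end SpaceC1

/-! ### From the Fokker–Planck equation to the continuity equation -/

section ContinuityEquation

open Filter
open scoped Topology

variable {n : ℕ} {X : Set (E n)} {s T : ℝ} {F : E n → ℝ → E n}
  {S : E n → ℝ → Matrix (Fin n) (Fin n) ℝ} {ρ : E n → ℝ → ℝ}

theorem pderiv_mul {f g : E n → ℝ} {x : E n} (hf : DifferentiableAt ℝ f x)
    (hg : DifferentiableAt ℝ g x) (i : Fin n) :
    pderiv i (fun y => f y * g y) x = f x * pderiv i g x + g x * pderiv i f x := by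
  simp [pderiv, fderiv_fun_mul hf hg]

theorem pderiv_log {f : E n → ℝ} {x : E n} (hf : DifferentiableAt ℝ f x) (h : f x ≠ 0)
    (i : Fin n) : pderiv i (fun y => Real.log (f y)) x = (f x)⁻¹ * pderiv i f x := by
  simp [pderiv, fderiv.log hf h]

theorem differentiableAt_coord {u : E n → E n} {x : E n} (hu : DifferentiableAt ℝ u x)
    (i : Fin n) : DifferentiableAt ℝ (fun y => u y i) x :=
  (EuclideanSpace.proj (𝕜 := ℝ) i).differentiableAt.comp x hu

theorem pderiv_coord {u : E n → E n} {x : E n} (hu : DifferentiableAt ℝ u x) (i j : Fin n) :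
    pderiv i (fun y => u y j) x = fderiv ℝ u x (EuclideanSpace.single i 1) j := by
  have := (EuclideanSpace.proj (𝕜 := ℝ) j).hasFDerivAt.comp x hu.hasFDerivAt
  rw [pderiv, show (fun y => u y j) = (EuclideanSpace.proj (𝕜 := ℝ) j) ∘ u from rfl, this.fderiv]
  rfl

theorem divergence_smul_add_smul {u u' : E n → E n} {x : E n} (b c : ℝ)
    (hu : DifferentiableAt ℝ u x) (hu' : DifferentiableAt ℝ u' x) :
    divergence (fun y => b • u y + c • u' y) x = b * divergence u x + c * divergence u' x := by
  rw [divergence, divergence, divergence, Finset.mul_sum, Finset.mul_sum,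
    ← Finset.sum_add_distrib]
  refine Finset.sum_congr rfl fun i _ => ?_
  have h : HasFDerivAt (fun y => b • u y + c • u' y) (b • fderiv ℝ u x + c • fderiv ℝ u' x) x :=
    (hu.hasFDerivAt.const_smul b).add (hu'.hasFDerivAt.const_smul c)
  rw [pderiv_coord h.differentiableAt, pderiv_coord hu, pderiv_coord hu', h.fderiv]
  rfl

theorem divergence_congr {u u' : E n → E n} {x : E n} (h : u =ᶠ[𝓝 x] u') :
    divergence u x = divergence u' x := by
  refine Finset.sum_congr rfl fun i _ => ?_
  have : (fun y => u y i) =ᶠ[𝓝 x] fun y => u' y i := h.mono fun y hy => by simp only [hy]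
  rw [pderiv, pderiv, this.fderiv_eq]

theorem divergence_smul {f : E n → ℝ} {u : E n → E n} {x : E n} (hf : DifferentiableAt ℝ f x)
    (hu : DifferentiableAt ℝ u x) :
    divergence (fun y => f y • u y) x = fderiv ℝ f x (u x) + f x * divergence u x := by
  have hux : u x = ∑ i, u x i • EuclideanSpace.single i (1 : ℝ) := by
    ext j
    simp [Pi.single_apply]
  rw [hux, map_sum, divergence, divergence, Finset.mul_sum, ← Finset.sum_add_distrib]
  refine Finset.sum_congr rfl fun i _ => ?_
  have := pderiv_mul hf (differentiableAt_coord hu i) i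
  simp only [PiLp.smul_apply, smul_eq_mul, map_smul] at this ⊢
  rw [this, add_comm]
  rfl

/-- On `X`, where `ρ > 0`, the term `∇log ρ` equals `ρ⁻¹ ∇ρ`, so two spatial derivatives of `ρ` and
`Σ` suffice. -/
theorem spaceC1_probFlowVelocity {I : Set ℝ} (hX : IsOpen X) (hF : SpaceC1 X I F)
    (hS : ∀ i j, SpaceC2 X I (fun x t => S x t i j)) (hρ : SpaceC2 X I ρ)
    (hpos : ∀ t ∈ I, ∀ x ∈ X, 0 < ρ x t) : SpaceC1 X I (probFlowVelocity F S ρ) := by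
  have hinv := hρ.fst.inv fun t ht x hx => (hpos t ht x hx).ne'
  have h1 := SpaceC1.toLp (X := X) (I := I) fun i => (SpaceC1.sum Finset.univ fun j _ =>
    (hS i j).pderiv j).add (SpaceC1.sum Finset.univ fun j _ =>
      (hS i j).fst.mul (hinv.mul (hρ.pderiv j)))
  refine (hF.add (h1.clm_comp ((-(1 / 2 : ℝ)) • ContinuousLinearMap.id ℝ (E n)))).congr hX ?_
  intro t ht x hx
  have hlog := fun i => pderiv_log (hρ.fst.diff t ht x hx) (hpos t ht x hx).ne' i
  ext i
  simp [probFlowVelocity, rowDiv, mulVecE, grad, hlog, Matrix.mulVec, dotProduct]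
  ring

theorem smul_probFlowVelocity {t : ℝ} {x : E n} (hρ : DifferentiableAt ℝ (ρ · t) x)
    (hS : ∀ i j, DifferentiableAt ℝ (fun y => S y t i j) x) (hpos : 0 < ρ x t) :
    ρ x t • probFlowVelocity F S ρ x t
      = ρ x t • F x t - (1 / 2 : ℝ) • rowDiv (fun y => ρ y t • S y t) x := by
  ext i
  have hlog := fun i => pderiv_log hρ hpos.ne' i
  have hmul := fun j => pderiv_mul hρ (hS i j) j
  simp only [probFlowVelocity, rowDiv, mulVecE, grad, Matrix.mulVec, dotProduct, hlog,
    PiLp.smul_apply, PiLp.sub_apply, PiLp.add_apply, smul_eq_mul, Matrix.smul_apply, hmul,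
    Finset.sum_add_distrib, ← Finset.mul_sum]
  have : ∑ j, S x t i j * pderiv j (ρ · t) x
      = ρ x t * ∑ j, S x t i j * ((ρ x t)⁻¹ * pderiv j (ρ · t) x) := by
    rw [Finset.mul_sum]
    refine Finset.sum_congr rfl fun j _ => ?_
    field_simp
  rw [this]
  ring

theorem satisfiesContinuityEq_probFlowVelocity (hX : IsOpen X) (hF : SpaceC1 X (Icc s T) F)
    (hS : ∀ i j, SpaceC2 X (Icc s T) (fun x t => S x t i j))
    (hFP : IsFokkerPlanckSolution X s T F S ρ) (hpos : ∀ t ∈ Icc s T, ∀ x ∈ X, 0 < ρ x t) :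
    SatisfiesContinuityEq X s T (probFlowVelocity F S ρ) ρ := by
  intro t ht x hx
  have hv := spaceC1_probFlowVelocity hX hF hS hFP.smooth hpos
  have hρd := fun (y : E n) (hy : y ∈ X) => hFP.smooth.fst.diff t ht y hy
  have hflux : DifferentiableAt ℝ (fun y => ρ y t • probFlowVelocity F S ρ y t) x :=
    (hρd x hx).smul (hv.diff t ht x hx)
  have hρF : DifferentiableAt ℝ (fun y => ρ y t • F y t) x := (hρd x hx).smul (hF.diff t ht x hx)
  -- The row divergence of `ρ Σ` is expressed through two differentiable fluxes, so its divergence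
  -- splits by linearity.
  have hev : rowDiv (fun y => ρ y t • S y t) =ᶠ[𝓝 x] fun y =>
      (2 : ℝ) • (ρ y t • F y t) + (-2 : ℝ) • (ρ y t • probFlowVelocity F S ρ y t) := by
    filter_upwards [hX.eventually_mem hx] with y hy
    rw [smul_probFlowVelocity (hρd y hy) (fun i j => (hS i j).fst.diff t ht y hy)
      (hpos t ht y hy)]
    module
  refine ⟨hflux, (hFP.eqn t ht x hx).congr_deriv ?_⟩
  rw [fokkerPlanckRHS, divergence_congr hev, divergence_smul_add_smul 2 (-2) hρF hflux]
  ring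

end ContinuityEquation

/-! ### Transport of densities by the flow -/

section Transport

open Filter
open scoped Topology NNReal

variable {n : ℕ} {X : Set (E n)} {s T : ℝ} {v : E n → ℝ → E n} {ρ : E n → ℝ → ℝ}
  {Φ : ℝ → E n → E n}

/-- A field of class `C¹` in space is Lipschitz, with uniformly continuous derivative, in a tube
around a curve. -/
theorem SpaceC1.exists_tube (hX : IsOpen X) (hv : SpaceC1 X (Icc s T) v) {γ : ℝ → E n}
    (hγ : ContinuousOn γ (Icc s T)) (hγX : MapsTo γ (Icc s T) X) :
    ∃ δ > 0, ∃ K : ℝ≥0, (∀ t ∈ Icc s T, Metric.ball (γ t) δ ⊆ X) ∧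
      (∀ t ∈ Icc s T, LipschitzOnWith K (v · t) (Metric.ball (γ t) δ)) ∧
      ∀ ε > 0, ∃ η > 0, ∀ t ∈ Icc s T, ∀ y ∈ Metric.ball (γ t) η,
        ‖fderiv ℝ (v · t) y - fderiv ℝ (v · t) (γ t)‖ ≤ ε := by
  have hK : IsCompact (γ '' Icc s T) := isCompact_Icc.image_of_continuousOn hγ
  -- A closed thickening of the compact trajectory is compact and still inside `X`; this makes all
  -- the bounds uniform in time.
  obtain ⟨δ, hδ, hδX⟩ := hK.exists_cthickening_subset_open hX hγX.image_subset
  have hC : IsCompact (Metric.cthickening δ (γ '' Icc s T) ×ˢ Icc s T) :=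
    hK.cthickening.prod isCompact_Icc
  have hcont := hv.cont_fderiv.mono (prod_mono hδX (Subset.refl (Icc s T)))
  obtain ⟨M, hM⟩ := hC.exists_bound_of_continuousOn hcont
  have hball : ∀ t ∈ Icc s T, Metric.ball (γ t) δ ⊆ Metric.cthickening δ (γ '' Icc s T) :=
    fun t ht => (Metric.ball_subset_thickening (mem_image_of_mem γ ht) δ).trans
      (Metric.thickening_subset_cthickening _ _)
  refine ⟨δ, hδ, M.toNNReal, fun t ht => (hball t ht).trans hδX, fun t ht => ?_, fun ε hε => ?_⟩
  · refine (convex_ball (γ t) δ).lipschitzOnWith_of_nnnorm_hasFDerivWithin_le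
      (f' := fun y => fderiv ℝ (v · t) y)
      (fun y hy => (hv.diff t ht y (hδX (hball t ht hy))).hasFDerivAt.hasFDerivWithinAt)
      fun y hy => ?_
    rw [← norm_toNNReal]
    exact Real.toNNReal_le_toNNReal (hM (y, t) ⟨hball t ht hy, ht⟩)
  · obtain ⟨η, hη, hηε⟩ := Metric.uniformContinuousOn_iff.1
      (hC.uniformContinuousOn_of_continuous hcont) ε hε
    refine ⟨min η δ, lt_min hη hδ, fun t ht y hy => ?_⟩
    have hy1 := hball t ht (Metric.ball_subset_ball (min_le_right _ _) hy)
    have hy2 := hball t ht (Metric.mem_ball_self hδ)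
    have := hηε (y, t) ⟨hy1, ht⟩ (γ t, t) ⟨hy2, ht⟩ (by
      rw [Prod.dist_eq, dist_self]
      exact max_lt (Metric.ball_subset_ball (min_le_left _ _) hy) hη)
    rw [dist_eq_norm] at this
    exact this.le

theorem GeneratesFlow.continuousOn_trajectory (hΦ : GeneratesFlow X s T v Φ) {x : E n}
    (hx : x ∈ X) : ContinuousOn (Φ · x) (Icc s T) :=
  fun t ht => (hΦ.ode x hx t ht).continuousWithinAt

/-- Uniqueness backward in time: trajectories meeting at time `t` have the same initial point. -/
theorem GeneratesFlow.injOn (hX : IsOpen X) (hv : SpaceC1 X (Icc s T) v)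
    (hΦ : GeneratesFlow X s T v Φ) {t : ℝ} (ht : t ∈ Icc s T) : InjOn (Φ t) X := by
  intro x hx y hy hxy
  obtain ⟨δ, hδ, K, -, hlip, -⟩ := hv.exists_tube hX (hΦ.continuousOn_trajectory hy)
    fun τ hτ => hΦ.mapsTo τ hτ hy
  have hsub : Icc s t ⊆ Icc s T := Icc_subset_Icc_right ht.2
  have := trajectories_eq_of_final_eq (γ₀ := (Φ · y)) (γ := (Φ · x)) (v := fun τ x => v x τ) ht.1
    hδ (fun τ hτ => hlip τ (hsub hτ)) (fun τ hτ => (hΦ.ode y hy τ (hsub hτ)).mono hsub)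
    (fun τ hτ => (hΦ.ode x hx τ (hsub hτ)).mono hsub) hxy
  simpa [hΦ.init x hx, hΦ.init y hy] using this

/-- **Liouville's formula** for the determinant of a solution of a linear equation. -/
theorem hasDerivWithinAt_det {J : ℝ → E n →L[ℝ] E n} {A : E n →L[ℝ] E n} {I : Set ℝ} {t : ℝ}
    (hJ : HasDerivWithinAt J (A.comp (J t)) I t) :
    HasDerivWithinAt (fun τ => (J τ).det)
      ((∑ i, A (EuclideanSpace.single i 1) i) * (J t).det) I t := by
  let b := (EuclideanSpace.basisFun (Fin n) ℝ).toBasis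
  have hentry : ∀ (L : E n →L[ℝ] E n) i j,
      LinearMap.toMatrix b b (L : E n →ₗ[ℝ] E n) i j = L (EuclideanSpace.single j 1) i := by
    intro L i j
    simp [LinearMap.toMatrix_apply, b]
  have hdet : ∀ L : E n →L[ℝ] E n, L.det = (LinearMap.toMatrix b b (L : E n →ₗ[ℝ] E n)).det :=
    fun L => (LinearMap.det_toMatrix b _).symm
  have hmul : LinearMap.toMatrix b b (A : E n →ₗ[ℝ] E n)
      * LinearMap.toMatrix b b (J t : E n →ₗ[ℝ] E n)
      = LinearMap.toMatrix b b ((A.comp (J t) : E n →L[ℝ] E n) : E n →ₗ[ℝ] E n) := by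
    exact (LinearMap.toMatrix_comp b b b _ _).symm
  have := hasDerivWithinAt_matrix_det (M := fun τ => LinearMap.toMatrix b b (J τ : E n →ₗ[ℝ] E n))
    (B := LinearMap.toMatrix b b (A : E n →ₗ[ℝ] E n)) (I := I) (t := t) fun i j => by
      rw [hmul]
      simp only [hentry]
      have h1 := hJ.clm_apply (hasDerivWithinAt_const t I (EuclideanSpace.single j (1 : ℝ)))
      have h2 := (EuclideanSpace.proj (𝕜 := ℝ) i).hasFDerivAt.comp_hasDerivWithinAt t h1
      simpa [Function.comp_def] using h2
  simp only [hdet]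
  refine this.congr_deriv ?_
  rw [Matrix.trace]
  simp only [Matrix.diag_apply, hentry]

/-- The flow is differentiable in the initial value, and a solution of the continuity equation is
transported by it. -/
theorem GeneratesFlow.exists_hasFDerivAt_mul_det (hX : IsOpen X) (hsT : s ≤ T)
    (hv : SpaceC1 X (Icc s T) v) (hρ : SpaceC1 X (Icc s T) ρ)
    (hce : SatisfiesContinuityEq X s T v ρ) (hΦ : GeneratesFlow X s T v Φ) {x : E n} (hx : x ∈ X)
    {t : ℝ} (ht : t ∈ Icc s T) :
    ∃ J : E n →L[ℝ] E n, HasFDerivAt (Φ t) J x ∧ ρ (Φ t x) t * J.det = ρ x s := by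
  have hcont := hΦ.continuousOn_trajectory hx
  have hmaps : ∀ τ ∈ Icc s T, Φ τ x ∈ X := fun τ hτ => hΦ.mapsTo τ hτ hx
  obtain ⟨δ, hδ, K, hball, hlip, hunif⟩ := hv.exists_tube hX hcont hmaps
  have hA : ContinuousOn (fun τ => fderiv ℝ (v · τ) (Φ τ x)) (Icc s T) :=
    hv.cont_fderiv.comp (hcont.prodMk continuousOn_id) fun τ hτ => ⟨hmaps τ hτ, hτ⟩
  -- The linearized equation is solved in the space of operators, with left composition as its
  -- coefficient.
  obtain ⟨J, hJs, hJ⟩ := exists_linear_ode_solution hsT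
    ((ContinuousLinearMap.compL ℝ (E n) (E n) (E n)).continuous.comp_continuousOn hA)
    (ContinuousLinearMap.id ℝ (E n))
  refine ⟨J t, hasFDerivAt_flow (v := fun τ x => v x τ)
    (v' := fun τ y => fderiv ℝ (v · τ) y) hδ (hX.mem_nhds hx) hx hlip
    (fun τ hτ y hy => (hv.diff τ hτ y (hball τ hτ hy)).hasFDerivAt) hunif hΦ.init hΦ.ode hJs hJ
    t ht, ?_⟩
  -- The transport term `Dρ · v` cancels, leaving rate `-∇·v` for `ρ` and `∇·v` for the determinant.
  have hderiv : ∀ τ ∈ Icc s T,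
      HasDerivWithinAt (fun τ => ρ (Φ τ x) τ * (J τ).det) 0 (Icc s T) τ := by
    intro τ hτ
    have hρd := hρ.diff τ hτ _ (hmaps τ hτ)
    have hvd := hv.diff τ hτ _ (hmaps τ hτ)
    have h1 := hρ.hasDerivWithinAt_comp_curve hX (γ := (Φ · x)) hτ (hmaps τ hτ)
      (hΦ.ode x hx τ hτ) (hce τ hτ _ (hmaps τ hτ)).2
    refine (h1.mul (hasDerivWithinAt_det (hJ τ hτ))).congr_deriv ?_
    have h2 : divergence (v · τ) (Φ τ x)
        = ∑ i, fderiv ℝ (v · τ) (Φ τ x) (EuclideanSpace.single i 1) i :=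
      Finset.sum_congr rfl fun i _ => pderiv_coord hvd i i
    rw [divergence_smul hρd hvd, ← h2]
    ring
  have := constant_of_has_deriv_right_zero (fun τ hτ => (hderiv τ hτ).continuousWithinAt)
    (fun τ hτ => hasDerivWithinAt_Ici_of_Icc (hderiv τ (Ico_subset_Icc_self hτ)) hτ) t ht
  rw [this, hJs, hΦ.init x hx, ContinuousLinearMap.det, ContinuousLinearMap.coe_id,
    LinearMap.det_id, mul_one]

theorem isProbabilityMeasure_densityMeasure {η : E n → ℝ} (hX : MeasurableSet X)
    (hη : IsProbDensity X η) : IsProbabilityMeasure (densityMeasure X η) := by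
  refine ⟨?_⟩
  rw [densityMeasure, withDensity_apply _ MeasurableSet.univ, Measure.restrict_univ,
    ← ofReal_integral_eq_lintegral_ofReal hη.integrable
      ((ae_restrict_mem hX).mono fun x hx => hη.nonneg x hx), hη.integral_eq, ENNReal.ofReal_one]

/-- Change of variables: a density that satisfies the Jacobian identity is pushed forward to a
measure below the target density. -/
theorem map_densityMeasure_le {φ : E n → E n} {J : E n → E n →L[ℝ] E n} {η η' : E n → ℝ}
    (hX : MeasurableSet X) (hφ : MapsTo φ X X) (hinj : InjOn φ X)
    (hJ : ∀ x ∈ X, HasFDerivAt φ (J x) x) (hη' : ∀ x ∈ X, 0 ≤ η' x) (hη : ∀ x ∈ X, 0 ≤ η x)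
    (hdet : ∀ x ∈ X, η' (φ x) * (J x).det = η x) :
    (densityMeasure X η).map φ ≤ densityMeasure X η' := by
  have hc : ContinuousOn φ X := fun x hx => (hJ x hx).continuousAt.continuousWithinAt
  have hm : AEMeasurable φ (densityMeasure X η) :=
    (hc.aemeasurable hX).mono_ac (withDensity_absolutelyContinuous _ _)
  refine Measure.le_iff.2 fun B hB => ?_
  have hPB : MeasurableSet (X ∩ φ ⁻¹' B) := by
    have h := hX.subtype_image ((continuousOn_iff_continuous_domRestrict.1 hc).measurable hB)
    convert h using 1
    ext x
    simp [and_comm]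
  have hsub : X ∩ φ ⁻¹' B ⊆ X := inter_subset_left
  have hcv := lintegral_image_eq_lintegral_abs_det_fderiv_mul volume hPB
    (fun x hx => (hJ x (hsub hx)).hasFDerivWithinAt) (hinj.mono hsub)
    fun y => ENNReal.ofReal (η' y)
  rw [Measure.map_apply_of_aemeasurable hm hB, densityMeasure, densityMeasure,
    withDensity_apply' _ _, withDensity_apply _ hB, Measure.restrict_restrict hB]
  calc ∫⁻ x in φ ⁻¹' B, ENNReal.ofReal (η x) ∂volume.restrict X
      = ∫⁻ x in X ∩ φ ⁻¹' B, ENNReal.ofReal (η x) := by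
        rw [Measure.restrict_restrict' hX, inter_comm]
    _ = ∫⁻ x in X ∩ φ ⁻¹' B, ENNReal.ofReal |(J x).det| * ENNReal.ofReal (η' (φ x)) := by
        refine setLIntegral_congr_fun hPB fun x hx => ?_
        have hx' := hsub hx
        -- The sign of the determinant is not needed: `|det J| η'(φ x) = |η x| = η x`.
        rw [← ENNReal.ofReal_mul (abs_nonneg _), ← abs_of_nonneg (hη' _ (hφ hx')), ← abs_mul,
          mul_comm, hdet x hx', abs_of_nonneg (hη x hx')]
    _ = ∫⁻ y in φ '' (X ∩ φ ⁻¹' B), ENNReal.ofReal (η' y) := hcv.symm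
    -- Only an inclusion, since `φ` need not map onto `X`.
    _ ≤ ∫⁻ y in B ∩ X, ENNReal.ofReal (η' y) := by
        refine lintegral_mono_set ?_
        rintro _ ⟨x, ⟨hx, hxB⟩, rfl⟩
        exact ⟨hxB, hφ hx⟩

/-- An inequality between two probability measures is an equality, so conservation of mass replaces
surjectivity of the flow. -/
theorem GeneratesFlow.pfMeasure_densityMeasure (hX : IsOpen X) (hsT : s ≤ T)
    (hv : SpaceC1 X (Icc s T) v) (hρ : SpaceC1 X (Icc s T) ρ)
    (hce : SatisfiesContinuityEq X s T v ρ)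
    (hprob : ∀ t ∈ Icc s T, IsProbDensity X (fun x => ρ x t))
    (hΦ : GeneratesFlow X s T v Φ) {t : ℝ} (ht : t ∈ Icc s T) :
    pfMeasure (Φ t) (densityMeasure X (fun x => ρ x s)) = densityMeasure X (fun x => ρ x t) := by
  have hs : s ∈ Icc s T := left_mem_Icc.2 hsT
  have hex := fun x (hx : x ∈ X) => hΦ.exists_hasFDerivAt_mul_det hX hsT hv hρ hce hx ht
  choose! J hJ using hex
  have hle := map_densityMeasure_le hX.measurableSet (hΦ.mapsTo t ht) (hΦ.injOn hX hv ht)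
    (fun x hx => (hJ x hx).1) (hprob t ht).nonneg (hprob s hs).nonneg fun x hx => (hJ x hx).2
  have := isProbabilityMeasure_densityMeasure hX.measurableSet (hprob s hs)
  have := isProbabilityMeasure_densityMeasure hX.measurableSet (hprob t ht)
  have hc : ContinuousOn (Φ t) X := fun x hx => (hJ x hx).1.continuousAt.continuousWithinAt
  have hm : AEMeasurable (Φ t) (densityMeasure X (fun x => ρ x s)) :=
    (hc.aemeasurable hX.measurableSet).mono_ac (withDensity_absolutelyContinuous _ _)
  have : IsProbabilityMeasure (pfMeasure (Φ t) (densityMeasure X (fun x => ρ x s))) :=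
    Measure.isProbabilityMeasure_map hm
  exact Measure.eq_of_le_of_isProbabilityMeasure hle

theorem ae_eq_pfDensity {φ : E n → E n} {η η' : E n → ℝ} (hX : IsOpen X) (hη' : ContinuousOn η' X)
    (hnonneg : ∀ x ∈ X, 0 ≤ η' x)
    (h : pfMeasure φ (densityMeasure X η) = densityMeasure X η') :
    η' =ᵐ[volume.restrict X] pfDensity X φ η := by
  have hm : AEMeasurable (fun x => ENNReal.ofReal (η' x)) (volume.restrict X) :=
    (hη'.aemeasurable hX.measurableSet).ennreal_ofReal
  have := Measure.rnDeriv_withDensity₀ (volume.restrict X) hm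
  filter_upwards [this, ae_restrict_mem hX.measurableSet] with x hx hxX
  rw [pfDensity, h, densityMeasure, hx, ENNReal.toReal_ofReal (hnonneg x hxX)]

end Transport

end ProbFlow

theorem theorem1 {n m p q : ℕ} (X : Set (ProbFlow.E n)) (hX : IsOpen X)
    (s T : ℝ) (hsT : s ≤ T)
    (f : ProbFlow.E n → ℝ → ProbFlow.E n)
    (g : ProbFlow.E n → ℝ → Matrix (Fin n) (Fin m) ℝ)
    (ψ : ProbFlow.E n → ℝ → Matrix (Fin n) (Fin p) ℝ)
    (ucl : ProbFlow.E n → ℝ → ProbFlow.E m) (w : ℝ → ProbFlow.E p)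
    (σ : ProbFlow.E n → ℝ → Matrix (Fin n) (Fin q) ℝ)
    (F : ProbFlow.E n → ℝ → ProbFlow.E n) (hF : F = ProbFlow.closedLoop f g ψ ucl w)
    (hFsmooth : ProbFlow.SpaceC1 X (Set.Icc s T) F)
    (hSsmooth : ∀ i j, ProbFlow.SpaceC2 X (Set.Icc s T)
      (fun x t => ProbFlow.diffusion σ x t i j))
    (ρ : ProbFlow.E n → ℝ → ℝ)
    (hFP : ProbFlow.IsFokkerPlanckSolution X s T F (ProbFlow.diffusion σ) ρ)
    (hpos : ∀ t ∈ Set.Icc s T, ∀ x ∈ X, 0 < ρ x t)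
    (v : ProbFlow.E n → ℝ → ProbFlow.E n)
    (hv : v = ProbFlow.probFlowVelocity F (ProbFlow.diffusion σ) ρ) :
    -- the continuity equation
    ProbFlow.SatisfiesContinuityEq X s T v ρ ∧
    -- transport by the flow of `v`, as measures and as densities
    ((∀ t ∈ Set.Icc s T, ProbFlow.IsProbDensity X (fun x => ρ x t)) →
      ∀ Φ : ℝ → ProbFlow.E n → ProbFlow.E n, ProbFlow.GeneratesFlow X s T v Φ →
      (∀ t ∈ Set.Icc s T,
        ProbFlow.pfMeasure (Φ t) (ProbFlow.densityMeasure X (fun x => ρ x s)) =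
            ProbFlow.densityMeasure X (fun x => ρ x t) ∧
        (fun x => ρ x t) =ᵐ[MeasureTheory.volume.restrict X]
          ProbFlow.pfDensity X (Φ t) (fun x => ρ x s)) ∧
      -- the one-time marginals of the stochastic dynamics are reproduced
      (∀ (Ω : Type*) [mΩ : MeasurableSpace Ω] (P : MeasureTheory.Measure Ω)
        [MeasureTheory.IsProbabilityMeasure P] (ℱ : MeasureTheory.Filtration ℝ mΩ)
        (Y : ℝ → Ω → ProbFlow.E n),
        ProbFlow.IsSDESolution X s T F σ P ℱ Y →
        (∀ t ∈ Set.Icc s T,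
          ProbabilityTheory.HasLaw (Y t) (ProbFlow.densityMeasure X (fun x => ρ x t)) P) →
        ∀ t ∈ Set.Icc s T, P.map (Y t) = ProbFlow.pfMeasure (Φ t) (P.map (Y s)))) := by
  subst hv
  have hce := ProbFlow.satisfiesContinuityEq_probFlowVelocity hX hFsmooth hSsmooth hFP hpos
  have hvs := ProbFlow.spaceC1_probFlowVelocity hX hFsmooth hSsmooth hFP.smooth hpos
  refine ⟨hce, fun hprob Φ hΦ => ?_⟩
  have hpush := fun t (ht : t ∈ Set.Icc s T) =>
    hΦ.pfMeasure_densityMeasure hX hsT hvs hFP.smooth.fst hce hprob ht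
  refine ⟨fun t ht => ⟨hpush t ht, ?_⟩, ?_⟩
  · refine ProbFlow.ae_eq_pfDensity hX (fun x hx => ?_) (hprob t ht).nonneg (hpush t ht)
    exact (hFP.smooth.fst.diff t ht x hx).continuousAt.continuousWithinAt
  · intro Ω mΩ P _ ℱ Y _ hlaw t ht
    rw [(hlaw t ht).map_eq, (hlaw s (Set.left_mem_Icc.2 hsT)).map_eq]
    exact (hpush t ht).symm
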